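/- **Setting.** Let $\mathcal T$ be a finite vocabulary and $\mathcal T^*$ the set of finite token sequences. An autoregressive model is a function $\mathcal M:\mathcal T^*\to\mathcal T$ sending a sequence to its next token; $\mathcal M(\bm p,\bm q,\bm a)$ is its value at the concatenation of a prompt $\bm p$, a question $\bm q$ and a partial answer $\bm a=\bm a_{1:t}$. A *T/C classification function* is a map $\mathcal F:\mathbb N\times\mathcal S\to\{T,C\}$, $(i,\bm x)\mapsto\mathcal F(i;\bm x)$, where $\mathcal S\subseteq\mathcal T^*$ contains the initial segments of its members and $\mathcal F$ is causal: if $\bm x,\bm y\in\mathcal S$ have the same first $k$ tokens, then the classes of these $k$ tokens in $\bm x$ and in $\bm y$ agree. Write $\mathcal F(\bm x)$ for the sequence of classes of the tokens of $\bm x$, and $\mathcal F(a_s)$ for the class of the token $a_s$ within the sequence in which it stands. Call $(\bm p,\bm q,\bm a)$ an *input* of $\mathcal F$ if $(\bm p,\bm q,\bm a)\in\mathcal S$, all tokens of $\bm p$ have class $T$ and all tokens of $\bm q$ have class $C$. Write $\mathcal F(\mathcal M(\bm x))$ for the class of the last token of $(\bm x,\mathcal M(\bm x))$; it is undefined if this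 sequence is not in $\mathcal S$, and an equality of two such expressions means that both are undefined or both are defined and equal. Two inputs $(\bm p,\bm q,\bm a_{1:t})$, $(\bm p,\bm q',\bm a'_{1:t})$ *have the same template* if $\mathcal F(\bm p,\bm q,\bm a_{1:t})=\mathcal F(\bm p,\bm q',\bm a'_{1:t})$ and $a_s=a'_s$ whenever $\mathcal F(a_s)=T$. Two inputs $(\bm p,\bm q,\bm a_{1:t})$, $(\bm p',\bm q,\bm a'_{1:t})$ *have the same content* if $\mathcal F(\bm p,\bm q,\bm a_{1:t})=\mathcal F(\bm p',\bm q,\bm a'_{1:t})$ and $a_s=a'_s$ whenever $\mathcal F(a_s)=C$. Then $\mathcal F$ is a *groundtruth classification* and $\mathcal M$ a *T-C model* for it if for any two inputs with the same template (1) $\mathcal F(\mathcal M(\bm p,\bm q,\bm a_{1:t}))=\mathcal F(\mathcal M(\bm p,\bm q',\bm a'_{1:t}))$, and (2) if both of these classes are $T$, then $\mathcal M(\bm p,\bm q,\bm a_{1:t})=\mathcal M(\bm p,\bm q',\bm a'_{1:t})$. A *Transformer* with context window $n$ takes at most $n$ tokens; it consists of a token embedding plus a position embedding, then a finite stack of layers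 (causally masked multi-head softmax self-attention, then a one-hidden-layer ReLU feed-forward network, both with residual connections, without layer norm), then a linear unembedding at the last position. It generates the token $b$ if the logit of $b$ is strictly larger than all other logits. Depth, width, number and size of heads, and size of the hidden layers are arbitrary. **Proposition (existence of the T-C Transformer).** Let $\mathcal F$ be a groundtruth T/C classification and $\mathcal M_I$ a T-C model for it. For every context window $n$ there are $d\in\mathbb N$, two causal Transformers without unembedding $f_T,f_C$ that map a sequence of length $k\le n$ to a sequence of $k$ vectors in $\mathbb R^d$, and an output Transformer $g$ (a stack of layers on $\mathbb R^{d}\oplus\mathbb R^{d}$ and an unembedding) such that the following holds. Let $\mathcal M$ be the Transformer whose embeddings are the concatenations of those of $f_T$ and $f_C$, whose first layers are the layers of $f_T$ and $f_C$ in parallel (the heads of both, each acting on its own block of coordinates, block-diagonal feed-forward networks, the shorter stack padded with identity layers), and whose last layers and unembedding are those of $g$. 1. For all $\bm p,\bm q,\bm a_{1:t}\in\mathcal T^*$ of total length between $1$ and $n$, $\mathcal M$ generates $\mathcal M_I(\bm p,\bm q,\bm a_{1:t})$, i.e. $\mathcal M(\bm p,\bm q,\bm a_{1:t})=\mathcal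 M_I(\bm p,\bm q,\bm a_{1:t})$. 2. On every sequence of length at most $n$, the hidden representation of $\mathcal M$ after the parallel layers is the concatenation of the outputs of $f_T$ and $f_C$. 3. $f_T$ takes equal values on any two inputs of length at most $n$ with the same template, and $f_C$ takes equal values on any two inputs of length at most $n$ with the same content. 4. If $(\bm p,\bm q,\bm a_{1:t})$ is an input of total length $k$, $1\le k\le n$, with $\mathcal F(\mathcal M_I(\bm p,\bm q,\bm a_{1:t}))=T$, then $g$ generates $\mathcal M_I(\bm p,\bm q,\bm a_{1:t})$ from the concatenation of $f_T(\bm p,\bm q,\bm a_{1:t})$ with an arbitrary sequence of $k$ vectors in $\mathbb R^d$ in place of the output of $f_C$. -/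

import Mathlib

open scoped Matrix

noncomputable section

/-! ### Template/content classification -/

/-- The two classes of tokens: template `T` and content `C`. -/
inductive TokenClass where
  | T : TokenClass
  | C : TokenClass

/-- A causal T/C classification function `F : ℕ × S → {T, C}` on a set `S` of token sequences.
Positions are counted from `0`; only positions inside the sequence carry meaning.
`S` contains the partial sequences `x.take k` of its members, so that `F` can be read off
while a text is being generated. -/
structure TCClassification (Tok : Type*) where
  /-- the domain `S` -/
  dom : Set (List Tok)
  /-- `label i x` is the class of the token number `i` of `x` -/
  label : ℕ → dom → TokenClass
  take_mem : ∀ x ∈ dom, ∀ k : ℕ, x.take k ∈ dom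
  /-- equal initial segments carry equal classes -/
  causal : ∀ (x y : dom) (k : ℕ), k ≤ x.1.length → k ≤ y.1.length → x.1.take k = y.1.take k →
    ∀ i < k, label i x = label i y

namespace TCClassification

variable {Tok : Type*} (F : TCClassification Tok)

/-- The T/C sequence `F(x)` of a whole token sequence. -/
def classes (x : F.dom) : List TokenClass :=
  (List.range x.1.length).map fun i => F.label i x

/-- `(p, q, a)` is a prompt, a question and a partial answer whose concatenation lies in the domain
of `F`; all prompt tokens are templates and all question tokens are contents. -/
structure IsInput (p q a : List Tok) : Prop where
  mem : p ++ q ++ a ∈ F.dom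
  prompt : ∀ i < p.length, F.label i ⟨p ++ q ++ a, mem⟩ = TokenClass.T
  question : ∀ i, p.length ≤ i → i < p.length + q.length →
    F.label i ⟨p ++ q ++ a, mem⟩ = TokenClass.C

/-- `(p, q, a)` and `(p, q', a')`, with the same prompt and with partial answers of the same length,
are T/C aligned and have the same template tokens. -/
structure SameTemplate (p q a q' a' : List Tok) : Prop where
  left : F.IsInput p q a
  right : F.IsInput p q' a'
  length_eq : a.length = a'.length
  aligned : F.classes ⟨p ++ q ++ a, left.mem⟩ = F.classes ⟨p ++ q' ++ a', right.mem⟩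
  same : ∀ s < a.length,
    F.label (p.length + q.length + s) ⟨p ++ q ++ a, left.mem⟩ = TokenClass.T → a[s]? = a'[s]?

/-- `(p, q, a)` and `(p', q, a')`, with the same question and with partial answers of the same
length, are T/C aligned and have the same content tokens. -/
structure SameContent (p q a p' a' : List Tok) : Prop where
  left : F.IsInput p q a
  right : F.IsInput p' q a'
  length_eq : a.length = a'.length
  aligned : F.classes ⟨p ++ q ++ a, left.mem⟩ = F.classes ⟨p' ++ q ++ a', right.mem⟩
  same : ∀ s < a.length,
    F.label (p.length + q.length + s) ⟨p ++ q ++ a, left.mem⟩ = TokenClass.C → a[s]? = a'[s]?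

open Classical in
/-- `F(M(x))`, the class of the token that the autoregressive model `M` appends to `x`. It is
undefined (`none`) if the extended sequence is outside the domain of `F`. -/
def nextClass (M : List Tok → Tok) (x : List Tok) : Option TokenClass :=
  if h : x ++ [M x] ∈ F.dom then some (F.label x.length ⟨x ++ [M x], h⟩) else none

/-- `F` is a groundtruth T/C classification and `M` is a T-C model for it. -/
structure IsGroundtruth (M : List Tok → Tok) : Prop where
  /-- aligned inputs with the same template tokens have next tokens of the same class -/
  next_class : ∀ p q a q' a' : List Tok, F.SameTemplate p q a q' a' →
    F.nextClass M (p ++ q ++ a) = F.nextClass M (p ++ q' ++ a')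
  /-- and if this class is `T`, then the next tokens are equal -/
  next_token : ∀ p q a q' a' : List Tok, F.SameTemplate p q a q' a' →
    F.nextClass M (p ++ q ++ a) = some TokenClass.T →
    F.nextClass M (p ++ q' ++ a') = some TokenClass.T →
    M (p ++ q ++ a) = M (p ++ q' ++ a')

end TCClassification

/-! ### Causal Transformers (without layer norm)

The coordinates of the hidden vectors are indexed by a finite type `ι`. A sequence of `k` hidden
vectors is a function `Fin k → ι → ℝ`, the rows of a `k × ι` matrix. -/

/-- A self-attention head with query, key, value and output matrices. -/
structure AttentionHead (ι : Type) where
  dim : ℕ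
  WQ : Matrix (Fin dim) ι ℝ
  WK : Matrix (Fin dim) ι ℝ
  WV : Matrix (Fin dim) ι ℝ
  WO : Matrix ι (Fin dim) ℝ

/-- A layer: a multi-head attention followed by a feed-forward network with one hidden layer. -/
structure TransformerLayer (ι : Type) where
  heads : List (AttentionHead ι)
  hidden : ℕ
  W₁ : Matrix (Fin hidden) ι ℝ
  b₁ : Fin hidden → ℝ
  W₂ : Matrix ι (Fin hidden) ℝ
  b₂ : ι → ℝ

section Forward

variable {ι : Type} [Fintype ι] {k : ℕ}

/-- The attention score `⟨W_Q X_i, W_K X_j⟩`. -/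
def AttentionHead.score (A : AttentionHead ι) (X : Fin k → ι → ℝ) (i j : Fin k) : ℝ :=
  (A.WQ *ᵥ X i) ⬝ᵥ (A.WK *ᵥ X j)

/-- The causally masked softmax: position `i` attends to the positions `j ≤ i` only. -/
def AttentionHead.weight (A : AttentionHead ι) (X : Fin k → ι → ℝ) (i j : Fin k) : ℝ :=
  if j ≤ i then Real.exp (A.score X i j) / ∑ l ∈ Finset.Iic i, Real.exp (A.score X i l) else 0

/-- The output of a head. -/
def AttentionHead.apply (A : AttentionHead ι) (X : Fin k → ι → ℝ) : Fin k → ι → ℝ :=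
  fun i => A.WO *ᵥ ∑ j, A.weight X i j • (A.WV *ᵥ X j)

/-- The attention block with its residual connection. -/
def TransformerLayer.attention (L : TransformerLayer ι) (X : Fin k → ι → ℝ) :
    Fin k → ι → ℝ :=
  X + (L.heads.map fun A => A.apply X).sum

/-- The row-wise ReLU feed-forward block with its residual connection. -/
def TransformerLayer.feedForward (L : TransformerLayer ι) (X : Fin k → ι → ℝ) :
    Fin k → ι → ℝ :=
  fun i => X i + L.W₂ *ᵥ (fun r => max ((L.W₁ *ᵥ X i + L.b₁) r) 0) + L.b₂

/-- One layer: attention block, then feed-forward block. -/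
def TransformerLayer.apply (L : TransformerLayer ι) (X : Fin k → ι → ℝ) :
    Fin k → ι → ℝ :=
  L.feedForward (L.attention X)

/-- A stack of layers; the head of the list is applied first. -/
def runLayers (Ls : List (TransformerLayer ι)) (X : Fin k → ι → ℝ) : Fin k → ι → ℝ :=
  Ls.foldl (fun Y L => L.apply Y) X

end Forward

/-- A Transformer with context window `n` from token sequences to sequences of hidden vectors:
token embedding plus position embedding, followed by a stack of layers. -/
structure Extractor (Tok : Type*) (n : ℕ) (ι : Type) where
  tokenEmbedding : Tok → ι → ℝ
  positionEmbedding : Fin n → ι → ℝ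
  layers : List (TransformerLayer ι)

/-- A Transformer from sequences of hidden vectors to the next token: a stack of layers, followed
by the unembedding. -/
structure OutputTransformer (Tok : Type*) (ι : Type) where
  layers : List (TransformerLayer ι)
  unembedding : Matrix Tok ι ℝ

/-- A complete causal Transformer with context window `n`. -/
structure CausalTransformer (Tok : Type*) (n : ℕ) (ι : Type) where
  tokenEmbedding : Tok → ι → ℝ
  positionEmbedding : Fin n → ι → ℝ
  layers : List (TransformerLayer ι)
  unembedding : Matrix Tok ι ℝ

section Run

variable {Tok : Type*} {n : ℕ} {ι : Type} [Fintype ι]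

/-- The hidden vectors at all positions. -/
def Extractor.run (f : Extractor Tok n ι) (x : List Tok) (hx : x.length ≤ n) :
    Fin x.length → ι → ℝ :=
  runLayers f.layers fun i =>
    f.tokenEmbedding (x.get i) + f.positionEmbedding (Fin.castLE hx i)

/-- The hidden vectors at all positions, as a list. -/
def Extractor.rows (f : Extractor Tok n ι) (x : List Tok) (hx : x.length ≤ n) :
    List (ι → ℝ) :=
  List.ofFn (f.run x hx)

/-- The logits of the next token, computed at the last position. -/
def OutputTransformer.logits (g : OutputTransformer Tok ι) {k : ℕ} (hk : 0 < k)
    (X : Fin k → ι → ℝ) : Tok → ℝ :=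
  g.unembedding *ᵥ runLayers g.layers X ⟨k - 1, Nat.sub_lt hk Nat.one_pos⟩

/-- The next token is `b`: its logit is strictly larger than all others. -/
def OutputTransformer.Generates (g : OutputTransformer Tok ι) {k : ℕ} (hk : 0 < k)
    (X : Fin k → ι → ℝ) (b : Tok) : Prop :=
  ∀ c : Tok, c ≠ b → g.logits hk X c < g.logits hk X b

/-- The logits of the next token, computed at the last position. -/
def CausalTransformer.logits (M : CausalTransformer Tok n ι) (x : List Tok)
    (hpos : 0 < x.length) (hx : x.length ≤ n) : Tok → ℝ :=
  M.unembedding *ᵥ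
    runLayers M.layers
      (fun i => M.tokenEmbedding (x.get i) + M.positionEmbedding (Fin.castLE hx i))
      ⟨x.length - 1, Nat.sub_lt hpos Nat.one_pos⟩

/-- The next token is `b`: its logit is strictly larger than all others. -/
def CausalTransformer.Generates (M : CausalTransformer Tok n ι) (x : List Tok)
    (hpos : 0 < x.length) (hx : x.length ≤ n) (b : Tok) : Prop :=
  ∀ c : Tok, c ≠ b → M.logits x hpos hx c < M.logits x hpos hx b

end Run

/-! ### Parallel combination and stacking -/

section Combine

variable {ι κ : Type}

/-- The concatenation of two sequences of hidden vectors along the feature dimension. -/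
def concatFeatures {k : ℕ} (X : Fin k → ι → ℝ) (Y : Fin k → κ → ℝ) :
    Fin k → ι ⊕ κ → ℝ :=
  fun i => Sum.elim (X i) (Y i)

/-- A head on the first block of features. -/
def AttentionHead.inl (A : AttentionHead ι) : AttentionHead (ι ⊕ κ) where
  dim := A.dim
  WQ := Matrix.fromCols A.WQ 0
  WK := Matrix.fromCols A.WK 0
  WV := Matrix.fromCols A.WV 0
  WO := Matrix.fromRows A.WO 0

/-- A head on the second block of features. -/
def AttentionHead.inr (A : AttentionHead κ) : AttentionHead (ι ⊕ κ) where
  dim := A.dim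
  WQ := Matrix.fromCols 0 A.WQ
  WK := Matrix.fromCols 0 A.WK
  WV := Matrix.fromCols 0 A.WV
  WO := Matrix.fromRows 0 A.WO

/-- Two layers in parallel: the heads of both, and a block-diagonal feed-forward network. -/
def TransformerLayer.par (L : TransformerLayer ι) (L' : TransformerLayer κ) :
    TransformerLayer (ι ⊕ κ) where
  heads := L.heads.map AttentionHead.inl ++ L'.heads.map AttentionHead.inr
  hidden := L.hidden + L'.hidden
  W₁ := (Matrix.fromBlocks L.W₁ 0 0 L'.W₁).reindex finSumFinEquiv (Equiv.refl _)
  b₁ := Sum.elim L.b₁ L'.b₁ ∘ finSumFinEquiv.symm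
  W₂ := (Matrix.fromBlocks L.W₂ 0 0 L'.W₂).reindex (Equiv.refl _) finSumFinEquiv
  b₂ := Sum.elim L.b₂ L'.b₂

/-- The layer that computes the identity. -/
def TransformerLayer.idle (ι : Type) : TransformerLayer ι where
  heads := []
  hidden := 0
  W₁ := 0
  b₁ := 0
  W₂ := 0
  b₂ := 0

/-- Two stacks in parallel; the shorter one is padded with identity layers. -/
def parLayers (Ls : List (TransformerLayer ι)) (Ls' : List (TransformerLayer κ)) :
    List (TransformerLayer (ι ⊕ κ)) :=
  List.zipWith TransformerLayer.par
    (Ls ++ List.replicate (Ls'.length - Ls.length) (TransformerLayer.idle ι))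
    (Ls' ++ List.replicate (Ls.length - Ls'.length) (TransformerLayer.idle κ))

variable {Tok : Type*} {n : ℕ}

/-- Two extractors in parallel. -/
def Extractor.par (f : Extractor Tok n ι) (f' : Extractor Tok n κ) :
    Extractor Tok n (ι ⊕ κ) where
  tokenEmbedding := fun b => Sum.elim (f.tokenEmbedding b) (f'.tokenEmbedding b)
  positionEmbedding := fun i => Sum.elim (f.positionEmbedding i) (f'.positionEmbedding i)
  layers := parLayers f.layers f'.layers

/-- The Transformer whose first layers are those of `f` and whose last layers are those of `g`. -/
def Extractor.stack (f : Extractor Tok n ι) (g : OutputTransformer Tok ι) :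
    CausalTransformer Tok n ι where
  tokenEmbedding := f.tokenEmbedding
  positionEmbedding := f.positionEmbedding
  layers := f.layers ++ g.layers
  unembedding := g.unembedding

end Combine

end

noncomputable section

/-! ### ReLU networks of one real variable -/

/-! Only sequences of length at most `n` matter, and there are finitely many, so a Transformer can
tabulate. In `exists_extractor_run_eq` one head with scores proportional to the position averages
the token digits with weights `B ^ j`; together with a position term proportional to the length,
this average encodes the prefix injectively in one real number (`prefixCode_injOn`). A ReLU network
of one variable takes prescribed values at these finitely many codes
(`IsReluNet.exists_eqOn_intervals`), so a single layer computes any function of the prefix.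

Masking the tokens of the other class gives a template key and a content key. By causality the keys
of all prefixes are invariant under equal template, respectively equal content, and together the two
keys determine the sequence (`eq_of_keys_eq`). Number the keys by `t` and `c ≤ N`; `f_T` outputs `t
* (N + 1)` and `f_C` outputs `c`. The output Transformer clips the content coordinate to `[0, N]`,
adds it to the template coordinate and decodes the sum. If the next token is a template, the
groundtruth property makes it a function of `t` alone (`IsGroundtruth.eq_of_templateKey_eq`), so the
whole interval `[t * (N + 1), t * (N + 1) + N]` can be decoded to it, and the content representation
becomes irrelevant. Otherwise the single point `t * (N + 1) + c` is decoded. -/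

/-- `g` is computed by a network with one hidden ReLU layer, whose input weights are `1`. -/
def IsReluNet {ι : Type*} (g : ℝ → ι → ℝ) : Prop :=
  ∃ (m : ℕ) (b : Fin m → ℝ) (W : Matrix ι (Fin m) ℝ),
    ∀ u, W *ᵥ (fun r => max (u + b r) 0) = g u

namespace IsReluNet

variable {ι : Type*}

theorem zero : IsReluNet (fun _ => (0 : ι → ℝ)) :=
  ⟨0, 0, 0, fun u => by simp⟩

theorem add_relu {g : ℝ → ι → ℝ} (hg : IsReluNet g) (t : ℝ) (v : ι → ℝ) :
    IsReluNet (fun u => g u + max (u - t) 0 • v) := by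
  obtain ⟨m, b, W, h⟩ := hg
  refine ⟨m + 1, Fin.snoc b (-t), Matrix.of fun i => Fin.snoc (W i) (v i), fun u => ?_⟩
  funext i
  have := congrFun (h u) i
  simp only [Matrix.mulVec, dotProduct] at this
  simp [Matrix.mulVec, dotProduct, Fin.sum_univ_castSucc, this, sub_eq_add_neg, mul_comm]

/-- Adding a step of height `v` that rises between `s` and `t`. -/
theorem add_step {g : ℝ → ι → ℝ} (hg : IsReluNet g) {s t : ℝ} (hst : s < t) (v : ι → ℝ) :
    ∃ g', IsReluNet g' ∧ (∀ u ≤ s, g' u = g u) ∧ ∀ u, t ≤ u → g' u = g u + v := by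
  refine ⟨_, (hg.add_relu s ((t - s)⁻¹ • v)).add_relu t (-((t - s)⁻¹ • v)), fun u hu => ?_,
    fun u hu => ?_⟩
  · simp [max_eq_right (sub_nonpos.2 hu), max_eq_right (sub_nonpos.2 (hu.trans hst.le))]
  · have hne : t - s ≠ 0 := (sub_pos.2 hst).ne'
    funext i
    simp only [max_eq_left (sub_nonneg.2 hu), max_eq_left (sub_nonneg.2 (hst.le.trans hu)),
      Pi.add_apply, Pi.smul_apply, Pi.neg_apply, smul_eq_mul]
    field_simp
    ring

/-- Prescribed constant values on finitely many disjoint intervals are attained by a network. -/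
theorem exists_eqOn_intervals {α : Type*} [DecidableEq α] (S : Finset α) (lo hi : α → ℝ)
    (φ : α → ι → ℝ)
    (h : ∀ x ∈ S, ∀ y ∈ S, (lo x = lo y ∧ hi x = hi y ∧ φ x = φ y) ∨ hi x < lo y ∨ hi y < lo x)
    (hle : ∀ x ∈ S, lo x ≤ hi x) :
    ∃ g, IsReluNet g ∧ ∀ x ∈ S, ∀ u, lo x ≤ u → u ≤ hi x → g u = φ x := by
  -- The induction needs more: `g` is constant to the right of all intervals, so that a further
  -- interval can be handled by one more step.
  suffices ∃ g, IsReluNet g ∧ (∀ x ∈ S, ∀ u, lo x ≤ u → u ≤ hi x → g u = φ x) ∧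
      ∃ c, ∀ u, (∀ x ∈ S, hi x ≤ u) → g u = c from
    let ⟨g, h₁, h₂, _⟩ := this
    ⟨g, h₁, h₂⟩
  induction S using Finset.induction_on_max_value lo with
  | empty => exact ⟨_, zero, by simp, 0, fun _ _ => rfl⟩
  | insert a s ha hmax ih =>
    obtain ⟨g, hg, hgφ, c, hc⟩ := ih
      (fun x hx y hy => h x (Finset.mem_insert_of_mem hx) y (Finset.mem_insert_of_mem hy))
      (fun x hx => hle x (Finset.mem_insert_of_mem hx))
    have haa := hle a (Finset.mem_insert_self a s)
    by_cases hex : ∃ x ∈ s, lo x = lo a ∧ hi x = hi a ∧ φ x = φ a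
    · obtain ⟨x, hx, h₁, h₂, h₃⟩ := hex
      refine ⟨g, hg, fun y hy u hl hu => ?_, c, fun u hu =>
        hc u fun y hy => hu y (Finset.mem_insert_of_mem hy)⟩
      rcases Finset.mem_insert.1 hy with rfl | hy
      · rw [← h₃]
        exact hgφ x hx u (h₁ ▸ hl) (h₂ ▸ hu)
      · exact hgφ y hy u hl hu
    · have hlt : ∀ x ∈ s, hi x < lo a := fun x hx => by
        rcases h x (Finset.mem_insert_of_mem hx) a (Finset.mem_insert_self a s) with h' | h' | h'
        · exact absurd ⟨x, hx, h'⟩ hex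
        · exact h'
        · exact absurd (hmax x hx) (by linarith)
      -- The new interval lies to the right of all earlier ones; the step rises in the gap between
      -- `t` and `lo a` and leaves the earlier values untouched.
      obtain ⟨t, hta, ht⟩ : ∃ t < lo a, ∀ x ∈ s, hi x ≤ t := by
        rcases s.eq_empty_or_nonempty with rfl | hs
        · exact ⟨lo a - 1, by linarith, by simp⟩
        · exact ⟨s.sup' hs hi, (Finset.sup'_lt_iff hs).2 hlt, fun x hx => Finset.le_sup' hi hx⟩
      obtain ⟨g', hg', hlow, hhigh⟩ := hg.add_step hta (φ a - c)
      have key : ∀ u, lo a ≤ u → g' u = φ a := fun u hu => by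
        rw [hhigh u hu, hc u fun x hx => (hlt x hx).le.trans hu, add_sub_cancel]
      refine ⟨g', hg', fun y hy u hl hu => ?_, φ a, fun u hu =>
        key u (haa.trans (hu a (Finset.mem_insert_self a s)))⟩
      rcases Finset.mem_insert.1 hy with rfl | hy
      · exact key u hl
      · rw [hlow u (hu.trans (ht y hy))]
        exact hgφ y hy u hl hu

end IsReluNet

/-! ### Layers without attention heads -/

/-- A layer without heads that adds a network of the coordinate `c` to the hidden vectors. -/
theorem IsReluNet.exists_layer {ι : Type} [Fintype ι] [DecidableEq ι] {g : ℝ → ι → ℝ}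
    (hg : IsReluNet g) (c : ι) (hs : List (AttentionHead ι)) :
    ∃ L : TransformerLayer ι, L.heads = hs ∧
      ∀ (k : ℕ) (X : Fin k → ι → ℝ) (i : Fin k), L.feedForward X i = X i + g (X i c) := by
  obtain ⟨m, b, W, h⟩ := hg
  refine ⟨⟨hs, m, Matrix.of fun _ => Pi.single c 1, b, W, 0⟩, rfl, fun k X i => ?_⟩
  simp only [TransformerLayer.feedForward, add_zero, ← h]
  congr 3
  funext r
  simp [Matrix.mulVec]

theorem TransformerLayer.apply_of_heads_eq_nil {ι : Type} [Fintype ι] {k : ℕ}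
    (L : TransformerLayer ι) (h : L.heads = []) (X : Fin k → ι → ℝ) :
    L.apply X = L.feedForward X := by
  simp [TransformerLayer.apply, TransformerLayer.attention, h]

/-! ### Transformers in parallel and in sequence -/

section Combine

variable {ι κ : Type} {k : ℕ}

theorem concatFeatures_add (X X' : Fin k → ι → ℝ) (Y Y' : Fin k → κ → ℝ) :
    concatFeatures (X + X') (Y + Y') = concatFeatures X Y + concatFeatures X' Y' := by
  funext i j
  cases j <;> rfl

theorem concatFeatures_zero_zero :
    concatFeatures (0 : Fin k → ι → ℝ) (0 : Fin k → κ → ℝ) = 0 := by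
  funext i j
  cases j <;> rfl

variable [Fintype ι] [Fintype κ]

theorem AttentionHead.inl_apply (A : AttentionHead ι) (X : Fin k → ι → ℝ) (Y : Fin k → κ → ℝ) :
    (A.inl : AttentionHead (ι ⊕ κ)).apply (concatFeatures X Y) =
      concatFeatures (A.apply X) 0 := by
  funext i
  have h : ∀ i j, (A.inl : AttentionHead (ι ⊕ κ)).score (concatFeatures X Y) i j =
      A.score X i j := fun i j => by
    simp [AttentionHead.score, AttentionHead.inl, concatFeatures, Matrix.fromCols_mulVec]
    rfl
  simp only [AttentionHead.apply, AttentionHead.weight, h]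
  change Matrix.fromRows A.WO 0 *ᵥ ∑ j, A.weight X i j •
    (Matrix.fromCols A.WV 0 *ᵥ Sum.elim (X j) (Y j)) = _
  simp only [Matrix.fromCols_mulVec, Sum.elim_comp_inl, Sum.elim_comp_inr, Matrix.zero_mulVec,
    add_zero, Matrix.fromRows_mulVec]
  rfl

theorem AttentionHead.inr_apply (A : AttentionHead κ) (X : Fin k → ι → ℝ) (Y : Fin k → κ → ℝ) :
    (A.inr : AttentionHead (ι ⊕ κ)).apply (concatFeatures X Y) =
      concatFeatures 0 (A.apply Y) := by
  funext i
  have h : ∀ i j, (A.inr : AttentionHead (ι ⊕ κ)).score (concatFeatures X Y) i j =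
      A.score Y i j := fun i j => by
    simp [AttentionHead.score, AttentionHead.inr, concatFeatures, Matrix.fromCols_mulVec]
    rfl
  simp only [AttentionHead.apply, AttentionHead.weight, h]
  change Matrix.fromRows 0 A.WO *ᵥ ∑ j, A.weight Y i j •
    (Matrix.fromCols 0 A.WV *ᵥ Sum.elim (X j) (Y j)) = _
  simp only [Matrix.fromCols_mulVec, Sum.elim_comp_inl, Sum.elim_comp_inr, Matrix.zero_mulVec,
    zero_add, Matrix.fromRows_mulVec]
  rfl

theorem TransformerLayer.par_attention (L : TransformerLayer ι) (L' : TransformerLayer κ)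
    (X : Fin k → ι → ℝ) (Y : Fin k → κ → ℝ) :
    (L.par L').attention (concatFeatures X Y) =
      concatFeatures (L.attention X) (L'.attention Y) := by
  have h₁ : ∀ l : List (AttentionHead ι),
      ((l.map AttentionHead.inl).map fun A => A.apply (concatFeatures X Y)).sum =
        concatFeatures (l.map fun A => A.apply X).sum 0 := fun l => by
    induction l with
    | nil => exact concatFeatures_zero_zero.symm
    | cons A l ih =>
      simp only [List.map_cons, List.sum_cons, ih, AttentionHead.inl_apply,
        ← concatFeatures_add, add_zero]
  have h₂ : ∀ l : List (AttentionHead κ),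
      ((l.map AttentionHead.inr).map fun A => A.apply (concatFeatures X Y)).sum =
        concatFeatures 0 (l.map fun A => A.apply Y).sum := fun l => by
    induction l with
    | nil => exact concatFeatures_zero_zero.symm
    | cons A l ih =>
      simp only [List.map_cons, List.sum_cons, ih, AttentionHead.inr_apply,
        ← concatFeatures_add, add_zero]
  simp only [TransformerLayer.attention, TransformerLayer.par, List.map_append, List.sum_append,
    h₁, h₂, ← concatFeatures_add, add_zero, zero_add]

theorem TransformerLayer.par_feedForward (L : TransformerLayer ι) (L' : TransformerLayer κ)
    (X : Fin k → ι → ℝ) (Y : Fin k → κ → ℝ) :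
    (L.par L').feedForward (concatFeatures X Y) =
      concatFeatures (L.feedForward X) (L'.feedForward Y) := by
  funext i j
  cases j
  · simp [TransformerLayer.feedForward, TransformerLayer.par, concatFeatures, Matrix.mulVec,
      dotProduct]
    -- The hidden units split into those of `L` and those of `L'`; the zero blocks of `W₂` remove
    -- the second group here.
    refine (Fin.sum_univ_add (a := L.hidden) (b := L'.hidden) _).trans ?_
    simp
    refine Finset.sum_congr rfl fun r _ => ?_
    congr 2
    change (∑ s, Matrix.fromBlocks L.W₁ 0 0 L'.W₁ (finSumFinEquiv.symm (Fin.castAdd L'.hidden r)) s *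
      Sum.elim (X i) (Y i) s) + Sum.elim L.b₁ L'.b₁ (finSumFinEquiv.symm (Fin.castAdd L'.hidden r)) = _
    simp
  · simp [TransformerLayer.feedForward, TransformerLayer.par, concatFeatures, Matrix.mulVec,
      dotProduct]
    refine (Fin.sum_univ_add (a := L.hidden) (b := L'.hidden) _).trans ?_
    simp
    refine Finset.sum_congr rfl fun r _ => ?_
    congr 2
    change (∑ s, Matrix.fromBlocks L.W₁ 0 0 L'.W₁ (finSumFinEquiv.symm (Fin.natAdd L.hidden r)) s *
      Sum.elim (X i) (Y i) s) + Sum.elim L.b₁ L'.b₁ (finSumFinEquiv.symm (Fin.natAdd L.hidden r)) = _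
    simp

theorem TransformerLayer.par_apply (L : TransformerLayer ι) (L' : TransformerLayer κ)
    (X : Fin k → ι → ℝ) (Y : Fin k → κ → ℝ) :
    (L.par L').apply (concatFeatures X Y) = concatFeatures (L.apply X) (L'.apply Y) := by
  simp only [TransformerLayer.apply, par_attention, par_feedForward]

theorem TransformerLayer.idle_apply (X : Fin k → ι → ℝ) :
    (TransformerLayer.idle ι).apply X = X := by
  funext i j
  simp [TransformerLayer.apply, TransformerLayer.attention, TransformerLayer.feedForward,
    TransformerLayer.idle]
  exact congrFun (Matrix.zero_mulVec _) j

theorem runLayers_append (Ls Ls' : List (TransformerLayer ι)) (X : Fin k → ι → ℝ) :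
    runLayers (Ls ++ Ls') X = runLayers Ls' (runLayers Ls X) := by
  simp [runLayers]

theorem runLayers_replicate_idle (m : ℕ) (X : Fin k → ι → ℝ) :
    runLayers (List.replicate m (TransformerLayer.idle ι)) X = X := by
  induction m with
  | zero => rfl
  | succ m ih =>
    rw [List.replicate_succ, runLayers, List.foldl_cons, TransformerLayer.idle_apply]
    exact ih

theorem runLayers_zipWith_par (Ls : List (TransformerLayer ι)) (Ls' : List (TransformerLayer κ))
    (h : Ls.length = Ls'.length) (X : Fin k → ι → ℝ) (Y : Fin k → κ → ℝ) :
    runLayers (List.zipWith TransformerLayer.par Ls Ls') (concatFeatures X Y) =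
      concatFeatures (runLayers Ls X) (runLayers Ls' Y) := by
  induction Ls generalizing Ls' X Y with
  | nil =>
    obtain rfl := List.length_eq_zero_iff.1 h.symm
    rfl
  | cons L Ls ih =>
    cases Ls' with
    | nil => simp at h
    | cons L' Ls' =>
      simp only [runLayers, List.zipWith_cons_cons, List.foldl_cons, TransformerLayer.par_apply]
      exact ih Ls' (by simpa using h) _ _

theorem runLayers_parLayers (Ls : List (TransformerLayer ι)) (Ls' : List (TransformerLayer κ))
    (X : Fin k → ι → ℝ) (Y : Fin k → κ → ℝ) :
    runLayers (parLayers Ls Ls') (concatFeatures X Y) =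
      concatFeatures (runLayers Ls X) (runLayers Ls' Y) := by
  rw [parLayers, runLayers_zipWith_par _ _ (by simp; omega)]
  simp only [runLayers_append, runLayers_replicate_idle]

variable {Tok : Type*} {n : ℕ}

theorem Extractor.par_run (f : Extractor Tok n ι) (f' : Extractor Tok n κ) (x : List Tok)
    (hx : x.length ≤ n) :
    (f.par f').run x hx = concatFeatures (f.run x hx) (f'.run x hx) := by
  rw [Extractor.run, Extractor.run, Extractor.run, ← runLayers_parLayers]
  congr 1
  funext i j
  cases j <;> rfl

theorem Extractor.stack_generates_iff (f : Extractor Tok n ι) (g : OutputTransformer Tok ι)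
    (x : List Tok) (hpos : 0 < x.length) (hx : x.length ≤ n) (b : Tok) :
    (f.stack g).Generates x hpos hx b ↔ g.Generates hpos (f.run x hx) b := by
  simp only [CausalTransformer.Generates, OutputTransformer.Generates, CausalTransformer.logits,
    OutputTransformer.logits, Extractor.stack, runLayers_append, Extractor.run]

end Combine
/-! ### One layer computes every function of the prefix -/

section Prefix

variable {Tok : Type*} [Fintype Tok]

/-- Tokens as the digits of the number system with base `card Tok + 2`. -/
def tokenDigit (b : Tok) : ℕ := Fintype.equivFin Tok b

theorem tokenDigit_injective : Function.Injective (tokenDigit : Tok → ℕ) :=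
  Fin.val_injective.comp (Fintype.equivFin Tok).injective

theorem tokenDigit_lt (b : Tok) : tokenDigit b < Fintype.card Tok + 2 :=
  (Fintype.equivFin Tok b).2.trans (by omega)

/-- The average of the digits with weights `base ^ j`, plus a multiple of the length. -/
def prefixCode (l : List Tok) : ℝ :=
  (Fintype.card Tok + 2 : ℕ) * l.length +
    (Nat.ofDigits (Fintype.card Tok + 2) (l.map tokenDigit) : ℕ) /
      ∑ j ∈ Finset.range l.length, ((Fintype.card Tok + 2 : ℕ) : ℝ) ^ j

/-- The weighted average of the digits lies in `[0, B)`, because `B ^ l.length` is at most `B` times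
the sum of the weights. The summand `B * l.length` therefore reveals the length; for equal lengths
the denominators agree, and the numerator determines the digits. The summand `2` in the base keeps
it above `1` for every alphabet. -/
theorem prefixCode_injOn : Set.InjOn (prefixCode (Tok := Tok)) {l | 0 < l.length} := by
  set B : ℕ := Fintype.card Tok + 2 with hB
  have hB0 : (0 : ℝ) < B := by positivity
  have hZ : ∀ l : List Tok, 0 < l.length → 0 < ∑ j ∈ Finset.range l.length, (B : ℝ) ^ j :=
    fun l hl => Finset.sum_pos (fun j _ => by positivity) (by simpa using hl.ne')
  have hmem : ∀ l : List Tok, ∀ c ∈ l.map tokenDigit, c < B := fun l c hc => by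
    obtain ⟨b, -, rfl⟩ := List.mem_map.1 hc
    exact tokenDigit_lt b
  have hlt : ∀ l : List Tok, 0 < l.length →
      (Nat.ofDigits B (l.map tokenDigit) : ℕ) / ∑ j ∈ Finset.range l.length, (B : ℝ) ^ j < B := by
    intro l hl
    rw [div_lt_iff₀ (hZ l hl)]
    have h₁ : ((Nat.ofDigits B (l.map tokenDigit) : ℕ) : ℝ) < (B : ℝ) ^ l.length := by
      have := Nat.ofDigits_lt_base_pow_length (by omega) (hmem l)
      rw [List.length_map] at this
      exact_mod_cast this
    refine h₁.trans_le ?_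
    obtain ⟨m, hm⟩ := Nat.exists_eq_succ_of_ne_zero hl.ne'
    rw [hm, pow_succ', Finset.sum_range_succ]
    gcongr
    exact le_add_of_nonneg_left (Finset.sum_nonneg fun j _ => by positivity)
  have hle : ∀ l l' : List Tok, 0 < l.length → prefixCode l = prefixCode l' →
      0 < l'.length → l.length ≤ l'.length := by
    intro l l' hl h hl'
    by_contra! hcon
    have h₁ := hlt l' hl'
    have h₂ : 0 ≤ (Nat.ofDigits B (l.map tokenDigit) : ℕ) /
        ∑ j ∈ Finset.range l.length, (B : ℝ) ^ j := by positivity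
    have h₃ : ((l'.length : ℝ) + 1) ≤ l.length := by exact_mod_cast hcon
    have h₄ := mul_le_mul_of_nonneg_left h₃ hB0.le
    simp only [prefixCode, ← hB] at h
    linarith
  intro l hl l' hl' h
  have hlen : l.length = l'.length := le_antisymm (hle l l' hl h hl') (hle l' l hl' h.symm hl)
  have hnum : Nat.ofDigits B (l.map tokenDigit) = Nat.ofDigits B (l'.map tokenDigit) := by
    simp only [prefixCode, ← hB, hlen, add_right_inj] at h
    rw [div_left_inj' (hZ l' hl').ne'] at h
    exact_mod_cast h
  exact tokenDigit_injective.list_map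
    (Nat.ofDigits_inj_of_len_eq (by omega) (by simpa using hlen) (hmem l) (hmem l') hnum)

theorem ofDigits_take_eq_sum (B : ℕ) (D : List ℕ) (i : ℕ) (hi : i < D.length) :
    Nat.ofDigits B (D.take (i + 1)) = ∑ j ∈ Finset.range (i + 1), B ^ j * D.getD j 0 := by
  induction D generalizing i with
  | nil => simp at hi
  | cons c D ih =>
    cases i with
    | zero => simp
    | succ i =>
      rw [List.take_succ_cons, Nat.ofDigits_cons, ih i (by simpa using hi),
        Finset.sum_range_succ' _ (i + 1), Finset.mul_sum, add_comm]
      simp [pow_succ', mul_assoc]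

/-- The softmax head whose scores are the coordinates `2` and whose values are the
coordinates `3`, for hidden vectors with coordinate `1` equal to `1`. -/
def digitHead (β : ℝ) : AttentionHead (Fin 4) where
  dim := 1
  WQ := !![0, 1, 0, 0]
  WK := !![0, 0, β, 0]
  WV := !![0, 0, 0, 1]
  WO := !![1; 0; 0; 0]

theorem digitHead_apply {k : ℕ} (β : ℝ) (X : Fin k → Fin 4 → ℝ) (h : ∀ i, X i 1 = 1)
    (i : Fin k) :
    (digitHead β).apply X i =
      ![(∑ j ∈ Finset.Iic i, Real.exp (β * X j 2) * X j 3) /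
        ∑ j ∈ Finset.Iic i, Real.exp (β * X j 2), 0, 0, 0] := by
  have hs : ∀ i j, (digitHead β).score X i j = β * X j 2 := fun i j => by
    change (!![0, 1, 0, 0] *ᵥ X i : Fin 1 → ℝ) ⬝ᵥ (!![0, 0, β, 0] *ᵥ X j) = _
    simp [Matrix.mulVec, dotProduct, Fin.sum_univ_succ, h]
  have hv : ∑ j, (digitHead β).weight X i j • ((digitHead β).WV *ᵥ X j) = fun _ =>
      (∑ j ∈ Finset.Iic i, Real.exp (β * X j 2) * X j 3) /
        ∑ j ∈ Finset.Iic i, Real.exp (β * X j 2) := by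
    funext r
    have hV : ∀ j, ((digitHead β).WV *ᵥ X j) r = X j 3 := fun j => by
      have h₀ : ∀ r : Fin 1, (!![0, 0, 0, 1] *ᵥ X j : Fin 1 → ℝ) r = X j 3 := fun r => by
        fin_cases r
        simp [Matrix.mulVec, dotProduct, Fin.sum_univ_succ]
      exact h₀ r
    simp only [Finset.sum_apply, Pi.smul_apply, hV, smul_eq_mul, AttentionHead.weight, hs]
    rw [Finset.sum_div, ← Finset.sum_subset (Finset.subset_univ (Finset.Iic i))]
    · refine Finset.sum_congr rfl fun j hj => ?_
      rw [if_pos (Finset.mem_Iic.1 hj)]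
      ring
    · intro j _ hj
      rw [if_neg (fun h => hj (Finset.mem_Iic.2 h)), zero_mul]
  rw [AttentionHead.apply, hv]
  change (!![1; 0; 0; 0] : Matrix (Fin 4) (Fin 1) ℝ) *ᵥ _ = _
  funext r
  fin_cases r <;> simp [Matrix.mulVec, dotProduct]

theorem sum_Iic_eq_sum_range {k : ℕ} (i : Fin k) (f : ℕ → ℝ) :
    ∑ j ∈ Finset.Iic i, f j = ∑ j ∈ Finset.range (i + 1), f j := by
  refine Finset.sum_bij (fun j _ => (j : ℕ)) ?_ ?_ ?_ ?_
  · intro j hj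
    have : j ≤ i := Finset.mem_Iic.1 hj
    simp only [Finset.mem_range]
    omega
  · exact fun a _ b _ h => Fin.ext h
  · intro j hj
    have := Finset.mem_range.1 hj
    exact ⟨⟨j, by omega⟩, Finset.mem_Iic.2 (Fin.mk_le_of_le_val (by omega)), rfl⟩
  · exact fun _ _ => rfl

/-- Every function of the prefixes of length at most `n` is computed by an extractor with a single
layer. -/
theorem exists_extractor_run_eq (n : ℕ) (Φ : List Tok → Fin 4 → ℝ) :
    ∃ f : Extractor Tok n (Fin 4), ∀ (x : List Tok) (hx : x.length ≤ n) (i : Fin x.length),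
      f.run x hx i = Φ (x.take (i + 1)) := by
  classical
  set B : ℕ := Fintype.card Tok + 2 with hB
  have hB0 : (0 : ℝ) < B := by positivity
  -- The hidden vector after the attention block, as a function of the prefix. The feed-forward
  -- network will add `Φ - V`, which also cancels the residual connection.
  let V : List Tok → Fin 4 → ℝ := fun l =>
    ![prefixCode l, 1, (l.length - 1 : ℕ), ((l.map tokenDigit).getD (l.length - 1) 0 : ℕ)]
  have hfin : {l : List Tok | l.length ≤ n}.Finite := List.finite_length_le Tok n
  obtain ⟨g, hg, hgΦ⟩ := IsReluNet.exists_eqOn_intervals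
    (hfin.toFinset.filter fun l => 0 < l.length) prefixCode prefixCode
    (fun l => Φ l - V l) (fun l hl l' hl' => by
      rcases lt_trichotomy (prefixCode l) (prefixCode l') with h | h | h
      · exact Or.inr (Or.inl h)
      · obtain rfl := prefixCode_injOn (Finset.mem_filter.1 hl).2 (Finset.mem_filter.1 hl').2 h
        exact Or.inl ⟨rfl, rfl, rfl⟩
      · exact Or.inr (Or.inr h)) (fun _ _ => le_rfl)
  -- With `β = log B`, the exponentiated score of position `j` is `B ^ j`, the place value of its
  -- digit.
  obtain ⟨L, hheads, hL⟩ := hg.exists_layer 0 [digitHead (Real.log B)]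
  -- The first coordinate starts as `B * (i + 1)`, the length term of `prefixCode`; the head adds
  -- the average to it.
  refine ⟨⟨fun b => ![0, 0, 0, tokenDigit b], fun i => ![B * (i + 1), 1, i, 0], [L]⟩,
    fun x hx i => ?_⟩
  set X : Fin x.length → Fin 4 → ℝ := fun i => ![B * ((i : ℕ) + 1), 1, (i : ℕ), tokenDigit (x.get i)]
    with hX
  have hE : Extractor.run ⟨fun b => ![0, 0, 0, (tokenDigit b : ℝ)],
      fun i => ![(B : ℝ) * (i + 1), 1, i, 0], [L]⟩ x hx = L.apply X := by
    change L.apply _ = _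
    congr 1
    funext i r
    fin_cases r <;> simp [hX]
  have hlen : (x.take (i + 1)).length = i + 1 := by
    rw [List.length_take]
    omega
  have hexp : ∀ j : ℕ, Real.exp (Real.log B * j) = (B : ℝ) ^ j := fun j => by
    rw [mul_comm, Real.exp_nat_mul, Real.exp_log hB0]
  have hdig : ∀ j : Fin x.length, (tokenDigit (x.get j) : ℝ) =
      (((x.map tokenDigit).getD j 0 : ℕ) : ℝ) := fun j => by simp
  have hatt : L.attention X i = V (x.take (i + 1)) := by
    have h₁ : (∑ j ∈ Finset.Iic i, Real.exp (Real.log B * X j 2) * X j 3) =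
        (Nat.ofDigits B ((x.take (i + 1)).map tokenDigit) : ℕ) := by
      rw [List.map_take, ofDigits_take_eq_sum _ _ _ (by simp), Nat.cast_sum,
        ← sum_Iic_eq_sum_range i fun j => ((B ^ j * (x.map tokenDigit).getD j 0 : ℕ) : ℝ)]
      refine Finset.sum_congr rfl fun j _ => ?_
      rw [Nat.cast_mul, Nat.cast_pow, ← hexp, ← hdig]
      rfl
    have h₂ : (∑ j ∈ Finset.Iic i, Real.exp (Real.log B * X j 2)) =
        ∑ j ∈ Finset.range (i + 1), (B : ℝ) ^ j := by
      rw [← sum_Iic_eq_sum_range i fun j => (B : ℝ) ^ j]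
      exact Finset.sum_congr rfl fun j _ => hexp j
    have h₃ : (((x.take (i + 1)).map tokenDigit).getD i 0 : ℕ) = tokenDigit (x.get i) := by
      simp
    simp only [TransformerLayer.attention, hheads, List.map_cons, List.map_nil, List.sum_cons,
      List.sum_nil, add_zero, Pi.add_apply]
    rw [digitHead_apply _ _ (fun _ => rfl), h₁, h₂]
    simp only [V, prefixCode, hlen, Nat.add_sub_cancel, h₃]
    funext r
    fin_cases r <;> simp [hX, hB]
  rw [hE, TransformerLayer.apply, hL, hatt, show V (x.take (i + 1)) 0 = prefixCode _ from rfl,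
    hgΦ (x.take (i + 1)) _ _ le_rfl le_rfl, add_sub_cancel]
  rw [Finset.mem_filter, Set.Finite.mem_toFinset, Set.mem_ofPred_eq, hlen]
  omega

end Prefix
/-! ### Codes of the templates and of the contents -/

namespace TCClassification

variable {Tok : Type*} (F : TCClassification Tok)

open Classical in
/-- The tokens of class `c`, with all others masked. -/
def mask (c : TokenClass) (x : F.dom) : List (Option Tok) :=
  (List.range x.1.length).map fun i => if F.label i x = c then x.1[i]? else none

variable {F}

theorem mask_eq_of (c : TokenClass) (x y : F.dom) (hlen : x.1.length = y.1.length)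
    (hlabel : ∀ i < x.1.length, F.label i x = F.label i y)
    (htok : ∀ i < x.1.length, F.label i x = c → x.1[i]? = y.1[i]?) :
    F.mask c x = F.mask c y := by
  rw [mask, mask, ← hlen]
  refine List.map_congr_left fun i hi => ?_
  have hi := List.mem_range.1 hi
  rw [← hlabel i hi]
  split_ifs with h
  · exact htok i hi h
  · rfl

theorem length_eq_of_mask_eq {c : TokenClass} {x y : F.dom} (h : F.mask c x = F.mask c y) :
    x.1.length = y.1.length := by
  simpa [mask] using congrArg List.length h

/-- Inside the sequence `x[i]?` is never `none`, so `none` in a mask marks exactly the tokens of the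
other class. As there are two classes, one mask determines all classes. -/
theorem label_eq_iff_of_mask_eq {c : TokenClass} {x y : F.dom} (h : F.mask c x = F.mask c y)
    {i : ℕ} (hi : i < x.1.length) :
    (F.label i x = c ↔ F.label i y = c) ∧ (F.label i x = c → x.1[i]? = y.1[i]?) := by
  have hlen := length_eq_of_mask_eq h
  have hy : i < y.1.length := hlen ▸ hi
  have := congrArg (fun l => l[i]?) h
  simp only [mask, List.getElem?_map, List.getElem?_range hi, List.getElem?_range hy,
    Option.map_some, Option.some.injEq, List.getElem?_eq_getElem hi,
    List.getElem?_eq_getElem hy] at this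
  rw [List.getElem?_eq_getElem hi, List.getElem?_eq_getElem hy]
  split_ifs at this <;> simp_all

/-- This is where causality enters: a row of an extractor sees only a prefix, whose mask must be
readable from the mask of the whole sequence. -/
theorem mask_take (c : TokenClass) (x : F.dom) (k : ℕ) :
    F.mask c ⟨x.1.take k, F.take_mem x.1 x.2 k⟩ = (F.mask c x).take k := by
  rw [mask, mask, ← List.map_take, List.take_range, List.length_take]
  refine List.map_congr_left fun i hi => ?_
  have hi := List.mem_range.1 hi
  have hik : i < k := by omega
  rw [F.causal ⟨x.1.take k, F.take_mem x.1 x.2 k⟩ x (min k x.1.length)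
    (by simp) (by simp) (by simp [List.take_take]) i hi]
  simp [hik]

theorem length_eq_of_classes_eq {x y : F.dom} (h : F.classes x = F.classes y) :
    x.1.length = y.1.length := by
  simpa [classes] using congrArg List.length h

theorem label_eq_of_classes_eq {x y : F.dom} (h : F.classes x = F.classes y) {i : ℕ}
    (hi : i < x.1.length) : F.label i x = F.label i y := by
  have hy : i < y.1.length := length_eq_of_classes_eq h ▸ hi
  have := congrArg (fun l => l[i]?) h
  simpa [classes, List.getElem?_map, List.getElem?_range hi, List.getElem?_range hy] using this

/-- The prompt is shared, the questions have class `C` and are masked, and the answers agree on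
their template tokens. -/
theorem SameTemplate.mask_eq {p q a q' a' : List Tok} (h : F.SameTemplate p q a q' a') :
    F.mask .T ⟨p ++ q ++ a, h.left.mem⟩ = F.mask .T ⟨p ++ q' ++ a', h.right.mem⟩ := by
  have hlen : (p ++ q ++ a).length = (p ++ q' ++ a').length := length_eq_of_classes_eq h.aligned
  have hla := h.length_eq
  have hq : q.length = q'.length := by
    simp only [List.length_append] at hlen
    omega
  refine mask_eq_of _ _ _ hlen (fun i hi => label_eq_of_classes_eq h.aligned hi)
    fun i hi hT => ?_
  simp only [List.append_assoc]
  rcases lt_or_ge i p.length with h₁ | h₁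
  · rw [List.getElem?_append_left h₁, List.getElem?_append_left h₁]
  rw [List.getElem?_append_right h₁, List.getElem?_append_right h₁]
  rcases lt_or_ge i (p.length + q.length) with h₂ | h₂
  · rw [h.left.question i h₁ h₂] at hT
    cases hT
  · rw [List.getElem?_append_right (by omega), List.getElem?_append_right (by omega), ← hq]
    simp only [List.length_append] at hi
    refine h.same _ (by omega) ?_
    rw [show p.length + q.length + (i - p.length - q.length) = i by omega]
    exact hT

theorem SameContent.mask_eq {p q a p' a' : List Tok} (h : F.SameContent p q a p' a') :
    F.mask .C ⟨p ++ q ++ a, h.left.mem⟩ = F.mask .C ⟨p' ++ q ++ a', h.right.mem⟩ := by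
  have hlen : (p ++ q ++ a).length = (p' ++ q ++ a').length := length_eq_of_classes_eq h.aligned
  have hla := h.length_eq
  have hp : p.length = p'.length := by
    simp only [List.length_append] at hlen
    omega
  refine mask_eq_of _ _ _ hlen (fun i hi => label_eq_of_classes_eq h.aligned hi)
    fun i hi hC => ?_
  simp only [List.append_assoc]
  rcases lt_or_ge i p.length with h₁ | h₁
  · rw [h.left.prompt i h₁] at hC
    cases hC
  rw [List.getElem?_append_right h₁, List.getElem?_append_right (l₁ := p') (hp ▸ h₁),
    ← hp]
  rcases lt_or_ge i (p.length + q.length) with h₂ | h₂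
  · rw [List.getElem?_append_left (by omega), List.getElem?_append_left (by omega)]
  · rw [List.getElem?_append_right (by omega), List.getElem?_append_right (by omega)]
    simp only [List.length_append] at hi
    refine h.same _ (by omega) ?_
    rw [show p.length + q.length + (i - p.length - q.length) = i by omega]
    exact hC

/-- With empty prompt and question the class conditions are vacuous, so the groundtruth property
applies to any two members of the domain with equal template masks. -/
theorem isInput_nil_nil (x : F.dom) : F.IsInput [] [] x.1 where
  mem := x.2
  prompt := fun i hi => by simp at hi
  question := fun i _ hi => by simp at hi

theorem sameTemplate_of_mask_eq {x y : F.dom} (h : F.mask .T x = F.mask .T y) :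
    F.SameTemplate [] [] x.1 [] y.1 where
  left := isInput_nil_nil x
  right := isInput_nil_nil y
  length_eq := length_eq_of_mask_eq h
  aligned := by
    change F.classes x = F.classes y
    rw [classes, classes, ← length_eq_of_mask_eq h]
    refine List.map_congr_left fun i hi => ?_
    have := (label_eq_iff_of_mask_eq h (List.mem_range.1 hi)).1
    cases hx : F.label i x <;> cases hy : F.label i y <;> simp_all
  same := fun s hs hT => by
    refine (label_eq_iff_of_mask_eq h hs).2 ?_
    simpa using hT

variable (F) in
open Classical in
/-- The information about `x` that the template extractor may use; outside the domain of `F` this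
is the whole of `x`. -/
def templateKey (x : List Tok) : List (Option Tok) ⊕ List Tok :=
  if h : x ∈ F.dom then .inl (F.mask .T ⟨x, h⟩) else .inr x

variable (F) in
open Classical in
/-- The information about `x` that the content extractor uses. -/
def contentKey (x : List Tok) : List (Option Tok) :=
  if h : x ∈ F.dom then F.mask .C ⟨x, h⟩ else []

theorem templateKey_cases {x y : List Tok} (h : F.templateKey x = F.templateKey y) :
    x = y ∨ ∃ (hx : x ∈ F.dom) (hy : y ∈ F.dom), F.mask .T ⟨x, hx⟩ = F.mask .T ⟨y, hy⟩ := by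
  unfold templateKey at h
  split_ifs at h with hx hy hy
  · exact Or.inr ⟨hx, hy, Sum.inl_injective h⟩
  · exact Or.inl (Sum.inr_injective h)

/-- Each token survives in one of the two masks. Outside the domain the template key alone is the
full sequence. -/
theorem eq_of_keys_eq {x y : List Tok} (hT : F.templateKey x = F.templateKey y)
    (hC : F.contentKey x = F.contentKey y) : x = y := by
  rcases templateKey_cases hT with h | ⟨hx, hy, h⟩
  · exact h
  rw [contentKey, contentKey, dif_pos hx, dif_pos hy] at hC
  refine List.ext_getElem? fun i => ?_
  rcases lt_or_ge i x.length with hi | hi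
  · cases hl : F.label i ⟨x, hx⟩ with
    | T => exact (label_eq_iff_of_mask_eq h hi).2 hl
    | C => exact (label_eq_iff_of_mask_eq hC hi).2 hl
  · rw [List.getElem?_eq_none hi,
      List.getElem?_eq_none ((length_eq_of_mask_eq h).symm.trans_le hi)]

theorem SameTemplate.templateKey_take_eq {p q a q' a' : List Tok}
    (h : F.SameTemplate p q a q' a') (k : ℕ) :
    F.templateKey ((p ++ q ++ a).take k) = F.templateKey ((p ++ q' ++ a').take k) := by
  rw [templateKey, templateKey, dif_pos (F.take_mem _ h.left.mem k),
    dif_pos (F.take_mem _ h.right.mem k)]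
  have h₁ := mask_take .T ⟨p ++ q ++ a, h.left.mem⟩ k
  have h₂ := mask_take .T ⟨p ++ q' ++ a', h.right.mem⟩ k
  rw [h₁, h₂, h.mask_eq]

theorem SameContent.contentKey_take_eq {p q a p' a' : List Tok}
    (h : F.SameContent p q a p' a') (k : ℕ) :
    F.contentKey ((p ++ q ++ a).take k) = F.contentKey ((p' ++ q ++ a').take k) := by
  rw [contentKey, contentKey, dif_pos (F.take_mem _ h.left.mem k),
    dif_pos (F.take_mem _ h.right.mem k)]
  have h₁ := mask_take .C ⟨p ++ q ++ a, h.left.mem⟩ k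
  have h₂ := mask_take .C ⟨p' ++ q ++ a', h.right.mem⟩ k
  rw [h₁, h₂, h.mask_eq]

/-- If the next token after `x` is a template, then it is determined by the template key of `x`. -/
theorem IsGroundtruth.eq_of_templateKey_eq {M : List Tok → Tok} (hM : F.IsGroundtruth M)
    {x y : List Tok} (h : F.templateKey x = F.templateKey y) :
    F.nextClass M x = F.nextClass M y ∧ (F.nextClass M x = some .T → M x = M y) := by
  rcases templateKey_cases h with rfl | ⟨hx, hy, h⟩
  · exact ⟨rfl, fun _ => rfl⟩
  have hs := sameTemplate_of_mask_eq h
  have hc : F.nextClass M x = F.nextClass M y := hM.next_class _ _ _ _ _ hs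
  exact ⟨hc, fun hx => hM.next_token _ _ _ _ _ hs hx (hc ▸ hx)⟩

end TCClassification

/-! ### The output Transformer -/

/-- An output Transformer that decodes the next token from an interval in which the sum of the
first coordinate and of the first coordinate of the second block, clipped to `[0, N]`, lies. -/
theorem exists_outputTransformer_generates {Tok : Type*} [Fintype Tok] {α : Type*} (S : Finset α)
    (lo hi : α → ℝ) (out : α → Tok) (N : ℝ)
    (h : ∀ x ∈ S, ∀ y ∈ S,
      (lo x = lo y ∧ hi x = hi y ∧ out x = out y) ∨ hi x < lo y ∨ hi y < lo x)
    (hle : ∀ x ∈ S, lo x ≤ hi x) :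
    ∃ g : OutputTransformer Tok (Fin 4 ⊕ Fin 4), ∀ x ∈ S, ∀ (k : ℕ) (hk : 0 < k)
      (X : Fin k → Fin 4 ⊕ Fin 4 → ℝ),
      (∀ i, X i (.inl 1) = 0) → (∀ i, X i (.inl 2) = 1) →
      (∀ i : Fin k, (i : ℕ) = k - 1 →
        X i (.inl 0) + (max (X i (.inr 0)) 0 - max (X i (.inr 0) - N) 0) ∈
          Set.Icc (lo x) (hi x)) →
      g.Generates hk X (out x) := by
  classical
  obtain ⟨f, hf, hfS⟩ := IsReluNet.exists_eqOn_intervals (ι := Fin 4 ⊕ Fin 4) S lo hi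
    (fun x => Pi.single (.inl 1) (tokenDigit (out x) : ℝ))
    (fun x hx y hy => (h x hx y hy).imp_left fun h => ⟨h.1, h.2.1, by rw [h.2.2]⟩) hle
  obtain ⟨L₂, hL₂, hL₂f⟩ := hf.exists_layer (.inl 0) []
  -- For `N ≥ 0` the two ReLU units form the clipping map to `[0, N]`. They read the content
  -- coordinate and write to the template coordinate.
  obtain ⟨L₁, hL₁, hL₁f⟩ := ((IsReluNet.zero.add_relu 0
    (Pi.single (.inl 0) (1 : ℝ))).add_relu N (-Pi.single (.inl 0) (1 : ℝ))).exists_layer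
      (.inr 0 : Fin 4 ⊕ Fin 4) []
  -- With `d` the digit of the output token in coordinate `1` and the constant `1` in coordinate
  -- `2`, the logit of `b` is `d ^ 2 - (tokenDigit b - d) ^ 2`, which is strictly largest at the
  -- token with digit `d`.
  let U : Matrix Tok (Fin 4 ⊕ Fin 4) ℝ := Matrix.of fun b =>
    Sum.elim ![0, 2 * (tokenDigit b : ℝ), -(tokenDigit b : ℝ) ^ 2, 0] 0
  refine ⟨⟨[L₁, L₂], U⟩, fun x hx k hk X hX₁ hX₂ hX b hb => ?_⟩
  set i : Fin k := ⟨k - 1, Nat.sub_lt hk Nat.one_pos⟩ with hi_def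
  have hrun : runLayers [L₁, L₂] X = L₂.feedForward (L₁.feedForward X) := by
    rw [← L₁.apply_of_heads_eq_nil hL₁, ← L₂.apply_of_heads_eq_nil hL₂]
    rfl
  have hz : L₁.feedForward X i (.inl 0) ∈ Set.Icc (lo x) (hi x) := by
    rw [hL₁f]
    simpa [sub_eq_add_neg] using hX i rfl
  have hz₁ : L₁.feedForward X i (.inl 1) = 0 := by
    rw [hL₁f]
    simp [hX₁]
  have hz₂ : L₁.feedForward X i (.inl 2) = 1 := by
    rw [hL₁f]
    simp [hX₂]
  have hlog : ∀ c, OutputTransformer.logits ⟨[L₁, L₂], U⟩ hk X c =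
      2 * tokenDigit c * tokenDigit (out x) - (tokenDigit c : ℝ) ^ 2 := fun c => by
    rw [OutputTransformer.logits, hrun, hL₂f, hfS x hx _ hz.1 hz.2]
    simp [U, Matrix.mulVec, dotProduct, Fin.sum_univ_succ, ← hi_def, hz₁, hz₂]
    ring
  have hne : (tokenDigit b : ℝ) - tokenDigit (out x) ≠ 0 :=
    sub_ne_zero.2 fun h => hb (tokenDigit_injective (Nat.cast_injective h))
  rw [hlog, hlog]
  nlinarith [sq_pos_of_ne_zero hne]

end

/-! ### Choice of the codes and assembly of the Transformer -/

theorem mainTheorem4 {Tok : Type*} [Fintype Tok] (F : TCClassification Tok)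
    (M_I : List Tok → Tok) (hM : F.IsGroundtruth M_I) (n : ℕ) :
    ∃ (d : ℕ) (f_T f_C : Extractor Tok n (Fin d)) (g : OutputTransformer Tok (Fin d ⊕ Fin d)),
      -- the combined Transformer reproduces the next token on every input
      (∀ (p q a : List Tok) (hpos : 0 < (p ++ q ++ a).length) (hn : (p ++ q ++ a).length ≤ n),
        ((f_T.par f_C).stack g).Generates (p ++ q ++ a) hpos hn (M_I (p ++ q ++ a))) ∧
      -- its first layers output the concatenation of the two extracted representations
      (∀ (x : List Tok) (hn : x.length ≤ n),
        (f_T.par f_C).run x hn = concatFeatures (f_T.run x hn) (f_C.run x hn)) ∧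
      -- `f_T` is independent of the content tokens
      (∀ (p q a q' a' : List Tok), F.SameTemplate p q a q' a' →
        ∀ (hn : (p ++ q ++ a).length ≤ n) (hn' : (p ++ q' ++ a').length ≤ n),
          f_T.rows (p ++ q ++ a) hn = f_T.rows (p ++ q' ++ a') hn') ∧
      -- `f_C` is independent of the template tokens
      (∀ (p q a p' a' : List Tok), F.SameContent p q a p' a' →
        ∀ (hn : (p ++ q ++ a).length ≤ n) (hn' : (p' ++ q ++ a').length ≤ n),
          f_C.rows (p ++ q ++ a) hn = f_C.rows (p' ++ q ++ a') hn') ∧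
      -- if the next token is a template, `g` is independent of the content representation
      (∀ (p q a : List Tok), F.IsInput p q a →
        F.nextClass M_I (p ++ q ++ a) = some TokenClass.T →
        ∀ (hpos : 0 < (p ++ q ++ a).length) (hn : (p ++ q ++ a).length ≤ n)
          (H : Fin (p ++ q ++ a).length → Fin d → ℝ),
          g.Generates hpos (concatFeatures (f_T.run (p ++ q ++ a) hn) H)
            (M_I (p ++ q ++ a))) := by
  classical
  obtain ⟨e, he⟩ := exists_injective_nat (List (Option Tok) ⊕ List Tok)
  obtain ⟨e', he'⟩ := exists_injective_nat (List (Option Tok))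
  have hfin : {l : List Tok | l.length ≤ n}.Finite := List.finite_length_le Tok n
  let t : List Tok → ℕ := fun x => e (F.templateKey x)
  let c : List Tok → ℕ := fun x => e' (F.contentKey x)
  let N : ℕ := hfin.toFinset.sup c
  let free : List Tok → Prop := fun x => F.nextClass M_I x = some TokenClass.T
  -- Each template key owns a block of length `N`, with gaps between blocks. A template successor
  -- claims the whole block, any other successor (content or undefined class) only the point of its
  -- content code.
  let lo : List Tok → ℕ := fun x => t x * (N + 1) + if free x then 0 else c x
  let hi : List Tok → ℕ := fun x => t x * (N + 1) + if free x then N else c x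
  have hcN : ∀ x ∈ hfin.toFinset, c x ≤ N := fun x hx => Finset.le_sup hx
  have hle : ∀ x ∈ hfin.toFinset, lo x ≤ hi x := fun x _ => by
    simp only [lo, hi]
    split_ifs <;> omega
  have hlt : ∀ x ∈ hfin.toFinset, ∀ y, t x < t y → hi x < lo y := fun x hx y h => by
    have h₁ := Nat.mul_le_mul_right (N + 1) (Nat.succ_le_of_lt h)
    have h₂ := hcN x hx
    rw [Nat.succ_mul] at h₁
    simp only [lo, hi]
    split_ifs <;> omega
  have hdisj : ∀ x ∈ hfin.toFinset, ∀ y ∈ hfin.toFinset,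
      (lo x = lo y ∧ hi x = hi y ∧ M_I x = M_I y) ∨ hi x < lo y ∨ hi y < lo x := by
    intro x hx y hy
    rcases lt_trichotomy (t x) (t y) with h | h | h
    · exact Or.inr (Or.inl (hlt x hx y h))
    · obtain ⟨hcls, htok⟩ := hM.eq_of_templateKey_eq (he h)
      by_cases hf : free x
      · have hf' : free y := hcls.symm.trans hf
        exact Or.inl ⟨by simp [lo, h, hf, hf'], by simp [hi, h, hf, hf'], htok hf⟩
      -- Equal template keys give both sequences the same status, so in this block only single
      -- points occur; equal points force equal sequences.
      · have hf' : ¬ free y := fun h => hf (hcls.trans h)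
        simp only [lo, hi, if_neg hf, if_neg hf', h]
        rcases lt_trichotomy (c x) (c y) with h' | h' | h'
        · omega
        · obtain rfl := F.eq_of_keys_eq (he h) (he' h')
          exact Or.inl ⟨rfl, rfl, rfl⟩
        · omega
    · exact Or.inr (Or.inr (hlt y hy x h))
  obtain ⟨fT, hfT⟩ := exists_extractor_run_eq n
    fun x : List Tok => ![((t x * (N + 1) : ℕ) : ℝ), 0, 1, 0]
  obtain ⟨fC, hfC⟩ := exists_extractor_run_eq n fun x : List Tok => ![(c x : ℝ), 0, 0, 0]
  obtain ⟨g, hg⟩ := exists_outputTransformer_generates hfin.toFinset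
    (fun x => (lo x : ℝ)) (fun x => (hi x : ℝ)) M_I N
    (fun x hx y hy => by exact_mod_cast hdisj x hx y hy)
    (fun x hx => by exact_mod_cast hle x hx)
  have hN : (0 : ℝ) ≤ N := Nat.cast_nonneg N
  have hgen : ∀ (x : List Tok) (hpos : 0 < x.length) (hn : x.length ≤ n)
      (H : Fin x.length → Fin 4 → ℝ),
      (free x ∨ ∀ i : Fin x.length, (i : ℕ) = x.length - 1 → H i 0 = c x) →
      g.Generates hpos (concatFeatures (fT.run x hn) H) (M_I x) := by
    intro x hpos hn H hH
    have hx : x ∈ hfin.toFinset := hfin.mem_toFinset.2 hn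
    refine hg x hx _ hpos _ (fun i => ?_) (fun i => ?_) fun i hi_last => ?_
    · simp [concatFeatures, hfT]
    · simp [concatFeatures, hfT]
    · have hrow : fT.run x hn i 0 = ((t x * (N + 1) : ℕ) : ℝ) := by
        -- At the last position the visible prefix is the entire sequence.
        rw [hfT, List.take_of_length_le (by omega)]
        rfl
      change fT.run x hn i 0 + (max (H i 0) 0 - max (H i 0 - N) 0) ∈ _
      rw [hrow]
      by_cases hf : free x
      -- Whatever `H` is, its clipped value lies in `[0, N]`, so the sum stays in the block of `x`.
      · simp only [lo, hi, if_pos hf, Set.mem_Icc, add_zero]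
        rw [Nat.cast_add]
        rcases max_cases (H i 0) 0 with h₁ | h₁ <;> rcases max_cases (H i 0 - N) 0 with h₂ | h₂ <;>
          constructor <;> linarith
      · have hc := (hH.resolve_left hf) i hi_last
        have hcx : (c x : ℝ) ≤ N := by exact_mod_cast hcN x hx
        rw [hc, max_eq_left (Nat.cast_nonneg _), max_eq_right (by linarith)]
        simp only [lo, hi, if_neg hf, Set.mem_Icc]
        rw [Nat.cast_add, sub_zero]
        exact ⟨le_rfl, le_rfl⟩
  refine ⟨4, fT, fC, g, fun p q a hpos hn => ?_, fun x hn => fT.par_run fC x hn, ?_, ?_, ?_⟩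
  · rw [Extractor.stack_generates_iff, Extractor.par_run]
    refine hgen _ hpos hn _ (Or.inr fun i hi_last => ?_)
    rw [hfC, List.take_of_length_le (by omega)]
    rfl
  · intro p q a q' a' h hn hn'
    refine List.ext_getElem (by simpa [Extractor.rows] using
      TCClassification.length_eq_of_classes_eq h.aligned) fun i h₁ h₂ => ?_
    simp only [Extractor.rows, List.getElem_ofFn, hfT, t, h.templateKey_take_eq]
  · intro p q a p' a' h hn hn'
    refine List.ext_getElem (by simpa [Extractor.rows] using
      TCClassification.length_eq_of_classes_eq h.aligned) fun i h₁ h₂ => ?_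
    simp only [Extractor.rows, List.getElem_ofFn, hfC, c, h.contentKey_take_eq]
  · exact fun p q a _ hT hpos hn H => hgen _ hpos hn H (Or.inl hT)
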